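/- Let $N\ge 1$. Consider an $N$-qubit device with Hamiltonian of one- and two-qubit terms, controlled by $N+1$ binary switches $s=(s_1,\dots,s_{N+1})\in\{0,1\}^{N+1}$, $$H(s)=\sum_{k=1}^{N}\sum_{a\in\{x,y,z\}} B^{k}_{a}(s_k)\,\sigma_a^{(k)}\;+\;g(s_{N+1})\sum_{1\le i<j\le N}\ \sum_{a,b\in\{x,y,z\}}J^{ij}_{ab}\,\sigma_a^{(i)}\sigma_b^{(j)},$$ where $\sigma_a^{(k)}$ is the Pauli matrix $\sigma_a$ acting on the $k$-th qubit and all coefficients are real. Thus the $k$-th switch selects one of two local fields $B^k(0),B^k(1)\in\mathbb R^3$ on the $k$-th qubit, and the last switch selects one of two interaction strengths $g(0),g(1)\in\mathbb{R}$ (for instance it turns the interaction off and on). Assume that for every $k$ the vectors $B^k(0)$ and $B^k(1)$ are linearly independent, that $g(0)\neq g(1)$, and that the graph on $\{1,\dots,N\}$ in which $i<j$ are joined whenever $J^{ij}\ne 0$ is connected. Then these $N+1$ switches suffice for universal quantum computation on the device: every $W\in SU(2^N)$ can be written exactly as a finite product $$W=e^{-i t_n H(s^{(n)})}\cdots e^{-i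 t_2 H(s^{(2)})}\,e^{-i t_1 H(s^{(1)})}$$ with $n\ge 0$, switch positions $s^{(1)},\dots,s^{(n)}\in\{0,1\}^{N+1}$ and $t_1,\dots,t_n\in\mathbb R$. -/

import Mathlib

open scoped BigOperators

noncomputable section

/-- Operators on the state space of `N` qubits, as complex `2^N × 2^N` matrices. The rows and
columns are indexed by the computational basis states `x : Fin N → Fin 2`. -/
abbrev QubitOp (N : ℕ) : Type := Matrix (Fin N → Fin 2) (Fin N → Fin 2) ℂ

/-- The Pauli matrices `σ_x`, `σ_y`, `σ_z`. -/
def pauli : Fin 3 → Matrix (Fin 2) (Fin 2) ℂ :=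
  ![!![0, 1; 1, 0], !![0, -Complex.I; Complex.I, 0], !![1, 0; 0, -1]]

/-- `σ_a^{(k)}`: the Pauli matrix `σ_a` acting on the qubit `k`, that is
`1 ⊗ ⋯ ⊗ σ_a ⊗ ⋯ ⊗ 1` with `σ_a` in the `k`-th place. -/
def pauliAt {N : ℕ} (a : Fin 3) (k : Fin N) : QubitOp N :=
  Matrix.of fun x y => if ∀ j, j ≠ k → x j = y j then pauli a (x k) (y k) else 0

/-- The one-qubit term `v · σ^{(k)} = v_x σ_x^{(k)} + v_y σ_y^{(k)} + v_z σ_z^{(k)}`. -/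
def localField {N : ℕ} (k : Fin N) (v : Fin 3 → ℝ) : QubitOp N :=
  ∑ a, (v a : ℂ) • pauliAt a k

/-- The two-qubit interaction `∑_{i<j} ∑_{a,b} J^{ij}_{ab} σ_a^{(i)} σ_b^{(j)}`.
Only the entries `J i j` with `i < j` are used. -/
def interaction {N : ℕ} (J : Fin N → Fin N → Fin 3 → Fin 3 → ℝ) : QubitOp N :=
  ∑ i, ∑ j, if i < j then
    ∑ a, ∑ b, (J i j a b : ℂ) • (pauliAt a i * pauliAt b j) else 0

/-- The graph on the qubits whose edges are the pairs of qubits that interact. -/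
def couplingGraph {N : ℕ} (J : Fin N → Fin N → Fin 3 → Fin 3 → ℝ) : SimpleGraph (Fin N) :=
  SimpleGraph.fromRel fun i j => i < j ∧ J i j ≠ 0

/-- The Hamiltonian of an `N`-qubit device when its `N + 1` binary switches are in the position
`s`. Switch `k < N` sets the local field on the qubit `k` to one of the two values `B k false`,
`B k true`, and the last switch sets the strength of the interaction to one of the two values
`g false`, `g true` (for instance `0` and `1`, when it turns the interaction off and on). -/
def switchedHamiltonian {N : ℕ} (B : Fin N → Bool → Fin 3 → ℝ)
    (J : Fin N → Fin N → Fin 3 → Fin 3 → ℝ) (g : Bool → ℝ) (s : Fin (N + 1) → Bool) :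
    QubitOp N :=
  ∑ k, localField k (B k (s k.castSucc)) + (g (s (Fin.last N)) : ℂ) • interaction J

/-- A device with `M` binary switches, whose Hamiltonian is `H s` while the switches are in the
position `s`, is universal: every `W ∈ SU(2^N)` is exactly a finite product
`exp(-i t_n H(s_n)) ⋯ exp(-i t_1 H(s_1))` with `t_1, …, t_n` real. -/
def IsUniversal {N M : ℕ} (H : (Fin M → Bool) → QubitOp N) : Prop :=
  ∀ W ∈ Matrix.specialUnitaryGroup (Fin N → Fin 2) ℂ,
    ∃ l : List ((Fin M → Bool) × ℝ),
      (l.map fun p => NormedSpace.exp (-(Complex.I * (p.2 : ℂ)) • H p.1)).prod = W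

end

/-!
The products of evolutions form a monoid `G`. Let `L` be the real span of the traceless Hermitian
matrices `A` with `exp(-itA) ∈ G` for all real `t`. It contains the Hamiltonians of the device, and it
is closed under `i[·, ·]` (`commutator_mem_drivableSpan`), since it is invariant under conjugation by
`exp(-itA)`. The proof shows that `L` is the space of all traceless Hermitian matrices, and that this
forces `G` to contain `SU(2^N)`.

Flipping one switch puts into `L` the interaction and, on each qubit `k`, the difference
`B k true - B k false`. Bracketing this difference with the sum of the local fields gives every local
field on `k`, as `B k false` and `B k true` are independent (`localField_mem_of_switch`). With local
fields available, `L` is stable under the projections that select a Pauli matrix at a given qubit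
(`pauliProj_mem`), so each interacting pair yields all its two-qubit Pauli terms; connectedness
extends this to all pairs (`pairLabel_mem_of_connected`), and brackets then build all nonidentity Pauli
strings (`pauliString_mem_of_pairLabel_mem`). These span the traceless Hermitian matrices.

For the last step, products of evolutions along a spanning set of drivable Hamiltonians, completed by
the directions transverse to `SU(2^N)`, give a map with surjective derivative, so `G` contains a
neighbourhood of `1` in `SU(2^N)` (`eventually_mem_of_traceless_mem_drivableSpan`). Every element of
`SU(2^N)` is `exp(iK)` with `K` traceless Hermitian, hence a power of an element of that
neighbourhood. This gives exact products, not only approximations.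
-/

section

open scoped Matrix.Norms.L2Operator
open Complex Matrix

variable {n : Type*} [Fintype n] [DecidableEq n]

/-! ### Logarithms of unitary matrices -/

theorem exp_smul_unitary_conj_diagonal (U : unitaryGroup n ℂ) (d : n → ℝ) (c : ℂ) :
    NormedSpace.exp
        (c • ((U : Matrix n n ℂ) * diagonal (fun i => (d i : ℂ)) * star (U : Matrix n n ℂ))) =
      (U : Matrix n n ℂ) * diagonal (fun i => Complex.exp (c * d i)) * star (U : Matrix n n ℂ) := by
  have hinv : (U : Matrix n n ℂ)⁻¹ = star (U : Matrix n n ℂ) :=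
    Matrix.inv_eq_right_inv (Unitary.coe_mul_star_self U)
  have hu : IsUnit (U : Matrix n n ℂ) :=
    IsUnit.of_mul_eq_one _ (Unitary.coe_mul_star_self U)
  rw [← hinv, ← smul_mul_assoc, ← mul_smul_comm, Matrix.exp_conj _ _ hu, ← diagonal_smul,
    Matrix.exp_diagonal]
  congr 3
  ext i
  simp [Pi.coe_exp, Complex.exp_eq_exp_ℂ]

theorem Matrix.IsHermitian.eq_unitary_conj_diagonal {A : Matrix n n ℂ} (hA : A.IsHermitian) :
    ∃ (U : unitaryGroup n ℂ) (d : n → ℝ),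
      A = (U : Matrix n n ℂ) * diagonal (fun i => (d i : ℂ)) * star (U : Matrix n n ℂ) :=
  ⟨hA.eigenvectorUnitary, hA.eigenvalues, by
    conv_lhs => rw [hA.spectral_theorem, Unitary.conjStarAlgAut_apply]
    rfl⟩

theorem det_unitary_conj (U : unitaryGroup n ℂ) (D : Matrix n n ℂ) :
    ((U : Matrix n n ℂ) * D * star (U : Matrix n n ℂ)).det = D.det := by
  rw [det_mul_comm, ← mul_assoc, Unitary.coe_star_mul_self, one_mul]

theorem trace_unitary_conj (U : unitaryGroup n ℂ) (D : Matrix n n ℂ) :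
    ((U : Matrix n n ℂ) * D * star (U : Matrix n n ℂ)).trace = D.trace := by
  rw [trace_mul_comm, ← mul_assoc, Unitary.coe_star_mul_self, one_mul]

theorem exp_neg_I_smul_mem_unitaryGroup {A : Matrix n n ℂ} (hA : A.IsHermitian) (t : ℝ) :
    NormedSpace.exp (-(I * (t : ℂ)) • A) ∈ unitaryGroup n ℂ := by
  let := NormedAlgebra.restrictScalars ℚ ℂ (Matrix n n ℂ)
  apply NormedSpace.exp_mem_unitary_of_mem_skewAdjoint
  rw [skewAdjoint.mem_iff, star_smul, star_eq_conjTranspose, hA.eq]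
  simp

theorem det_exp_smul_of_isHermitian {A : Matrix n n ℂ} (hA : A.IsHermitian) (c : ℂ) :
    (NormedSpace.exp (c • A)).det = Complex.exp (c * A.trace) := by
  obtain ⟨U, d, rfl⟩ := hA.eq_unitary_conj_diagonal
  rw [exp_smul_unitary_conj_diagonal, det_unitary_conj, trace_unitary_conj, det_diagonal,
    trace_diagonal, Finset.mul_sum, Complex.exp_sum]

theorem exp_neg_I_smul_mem_specialUnitaryGroup {A : Matrix n n ℂ} (hA : A.IsHermitian)
    (h0 : A.trace = 0) (t : ℝ) : NormedSpace.exp (-(I * (t : ℂ)) • A) ∈ specialUnitaryGroup n ℂ := by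
  rw [mem_specialUnitaryGroup_iff]
  exact ⟨exp_neg_I_smul_mem_unitaryGroup hA t, by rw [det_exp_smul_of_isHermitian hA, h0]; simp⟩

/-- Every unitary matrix has a Hermitian logarithm. The principal argument is applied to the matrix
by the continuous functional calculus; its discontinuity on the negative real axis is harmless,
since every function is continuous on a finite spectrum. -/
theorem exists_isHermitian_exp_eq {W : Matrix n n ℂ} (hW : W ∈ unitaryGroup n ℂ) :
    ∃ K : Matrix n n ℂ, K.IsHermitian ∧ NormedSpace.exp (I • K) = W := by
  have hn : IsStarNormal W := ⟨by
    rw [Commute, SemiconjBy, (mem_unitaryGroup_iff).1 hW, (mem_unitaryGroup_iff').1 hW]⟩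
  have hfin : (spectrum ℂ W).Finite := Matrix.finite_spectrum W
  have hc : ∀ f : ℂ → ℂ, ContinuousOn f (spectrum ℂ W) := fun f => hfin.continuousOn f
  refine ⟨cfc (fun z : ℂ => (z.arg : ℂ)) W, ?_, ?_⟩
  · change star _ = _
    rw [← cfc_star]
    simp
  · rw [← cfc_smul I (fun z : ℂ => (z.arg : ℂ)) W (hc _),
      ← CFC.complex_exp_eq_normedSpace_exp,
      ← cfc_comp' Complex.exp _ W (Complex.continuous_exp.continuousOn) (hc _)]
    conv_rhs => rw [← cfc_id ℂ W]
    refine cfc_congr fun z hz => ?_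
    have h1 : ‖z‖ = 1 := by
      have := spectrum.subset_circle_of_unitary (𝕜 := ℂ) hW hz
      simpa using this
    have := Complex.norm_mul_exp_arg_mul_I z
    rw [h1] at this
    simpa [mul_comm] using this

/-- The logarithm of a matrix in `SU(n)` can be taken traceless: the trace of a Hermitian logarithm
lies in `2πℤ`, and subtracting it from a single eigenvalue leaves the exponential unchanged. -/
theorem exists_traceless_isHermitian_exp_eq {W : Matrix n n ℂ}
    (hW : W ∈ specialUnitaryGroup n ℂ) :
    ∃ K : Matrix n n ℂ, K.IsHermitian ∧ K.trace = 0 ∧ NormedSpace.exp (I • K) = W := by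
  rw [mem_specialUnitaryGroup_iff] at hW
  obtain ⟨K, hK, rfl⟩ := exists_isHermitian_exp_eq hW.1
  have hdet := hW.2
  rw [det_exp_smul_of_isHermitian hK, Complex.exp_eq_one_iff] at hdet
  obtain ⟨m, hm⟩ := hdet
  obtain ⟨U, d, rfl⟩ := hK.eq_unitary_conj_diagonal
  rw [trace_unitary_conj, trace_diagonal] at hm
  rcases isEmpty_or_nonempty n with he | ⟨⟨i₀⟩⟩
  · exact ⟨0, isHermitian_zero, by simp, Subsingleton.elim _ _⟩
  set d' : n → ℝ := fun i => d i - if i = i₀ then m * (2 * Real.pi) else 0 with hd'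
  refine ⟨(U : Matrix n n ℂ) * diagonal (fun i => (d' i : ℂ)) * star (U : Matrix n n ℂ), ?_, ?_, ?_⟩
  · rw [star_eq_conjTranspose]
    apply isHermitian_mul_mul_conjTranspose
    exact isHermitian_diagonal_iff.2 fun i => by simp [IsSelfAdjoint]
  · rw [trace_unitary_conj, trace_diagonal]
    have h2 : ∑ i, (d i : ℂ) = m * (2 * Real.pi) := by
      apply mul_left_cancel₀ I_ne_zero
      rw [hm]; ring
    simp only [hd', Complex.ofReal_sub, Finset.sum_sub_distrib, h2]
    simp [apply_ite Complex.ofReal]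
  · rw [exp_smul_unitary_conj_diagonal, exp_smul_unitary_conj_diagonal]
    congr 3
    ext i
    by_cases h : i = i₀
    · simp only [hd', h, if_true]
      rw [Complex.exp_eq_exp_iff_exists_int]
      exact ⟨-m, by push_cast; ring⟩
    · simp [hd', h]

/-! ### Submonoids that contain one-parameter groups -/

/-- The traceless Hermitian matrices `A` whose whole one-parameter group `exp(-itA)`, `t ∈ ℝ`, lies
in `G`. -/
def drivable (G : Submonoid (Matrix n n ℂ)) : Set (Matrix n n ℂ) :=
  {A | A.IsHermitian ∧ A.trace = 0 ∧ ∀ t : ℝ, NormedSpace.exp (-(I * (t : ℂ)) • A) ∈ G}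

/-- The real span of the Hamiltonians that can be driven inside `G`. -/
noncomputable def drivableSpan (G : Submonoid (Matrix n n ℂ)) : Submodule ℝ (Matrix n n ℂ) :=
  Submodule.span ℝ (drivable G)

theorem exp_neg_I_smul_mul_exp_neg (A : Matrix n n ℂ) (t : ℝ) :
    NormedSpace.exp (-(I * (t : ℂ)) • A) * NormedSpace.exp (-(I * ((-t : ℝ) : ℂ)) • A) = 1 := by
  rw [← Matrix.exp_add_of_commute _ _ ((Commute.refl A).smul_left _ |>.smul_right _), ← add_smul]
  simp

theorem exp_smul_conj_exp (A X : Matrix n n ℂ) (t : ℝ) (c : ℂ) :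
    NormedSpace.exp (c • (NormedSpace.exp (-(I * (t : ℂ)) • A) * X *
        NormedSpace.exp (-(I * ((-t : ℝ) : ℂ)) • A))) =
      NormedSpace.exp (-(I * (t : ℂ)) • A) * NormedSpace.exp (c • X) *
        NormedSpace.exp (-(I * ((-t : ℝ) : ℂ)) • A) := by
  have h2 := exp_neg_I_smul_mul_exp_neg A (-t)
  rw [neg_neg] at h2
  have := Matrix.exp_units_conj (⟨_, _, exp_neg_I_smul_mul_exp_neg A t, h2⟩ : (Matrix n n ℂ)ˣ) (c • X)
  simpa only [Units.inv_mk, mul_smul_comm, smul_mul_assoc] using this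

theorem conj_mem_drivable {G : Submonoid (Matrix n n ℂ)} {A X : Matrix n n ℂ}
    (hA : A ∈ drivable G) (hX : X ∈ drivable G) (t : ℝ) :
    NormedSpace.exp (-(I * (t : ℂ)) • A) * X * NormedSpace.exp (-(I * ((-t : ℝ) : ℂ)) • A) ∈
      drivable G := by
  have hstar : NormedSpace.exp (-(I * ((-t : ℝ) : ℂ)) • A) =
      (NormedSpace.exp (-(I * (t : ℂ)) • A))ᴴ := by
    rw [← Matrix.exp_conjTranspose, conjTranspose_smul, hA.1.eq]
    simp
  refine ⟨?_, ?_, fun s => ?_⟩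
  · rw [hstar]
    exact isHermitian_mul_mul_conjTranspose _ hX.1
  · have h2 := exp_neg_I_smul_mul_exp_neg A (-t)
    rw [neg_neg] at h2
    rw [trace_mul_comm, ← mul_assoc, h2, one_mul, hX.2.1]
  · rw [exp_smul_conj_exp]
    exact G.mul_mem (G.mul_mem (hA.2.2 t) (hX.2.2 s)) (hA.2.2 (-t))

theorem conj_mem_drivableSpan {G : Submonoid (Matrix n n ℂ)} {A X : Matrix n n ℂ}
    (hA : A ∈ drivable G) (hX : X ∈ drivableSpan G) (t : ℝ) :
    NormedSpace.exp (-(I * (t : ℂ)) • A) * X * NormedSpace.exp (-(I * ((-t : ℝ) : ℂ)) • A) ∈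
      drivableSpan G := by
  induction hX using Submodule.span_induction with
  | mem X h => exact Submodule.subset_span (conj_mem_drivable hA h t)
  | zero => simp
  | add X Y _ _ h1 h2 =>
    rw [mul_add, add_mul]
    exact Submodule.add_mem _ h1 h2
  | smul r X _ h =>
    rw [mul_smul_comm, smul_mul_assoc]
    exact Submodule.smul_mem _ r h

theorem hasStrictDerivAt_exp_real_smul (Y : Matrix n n ℂ) :
    HasStrictDerivAt (fun t : ℝ => NormedSpace.exp (t • Y)) Y 0 := by
  have h := hasStrictDerivAt_exp_smul_const (𝕂 := ℝ) Y (0 : ℝ)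
  simpa using h

theorem exp_neg_I_smul (A : Matrix n n ℂ) (t : ℝ) :
    NormedSpace.exp (-(I * (t : ℂ)) • A) = NormedSpace.exp (t • (-I • A)) := by
  congr 1
  ext i j
  simp; ring

/-- The span of the drivable Hamiltonians is closed under `(A, X) ↦ i[A, X]`: for drivable `A` it is
invariant under conjugation by `exp(-itA)`, and being closed it contains the derivative at `t = 0`.
-/
theorem commutator_mem_drivableSpan {G : Submonoid (Matrix n n ℂ)} {A X : Matrix n n ℂ}
    (hA : A ∈ drivableSpan G) (hX : X ∈ drivableSpan G) :
    I • (A * X - X * A) ∈ drivableSpan G := by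
  induction hA using Submodule.span_induction with
  | mem A h =>
    have hd : HasDerivAt (fun t : ℝ => NormedSpace.exp (t • (-I • A)) * X *
        NormedSpace.exp ((-t) • (-I • A))) ((-I • A) * X - X * (-I • A)) 0 := by
      have h1 := (hasStrictDerivAt_exp_real_smul (-I • A)).hasDerivAt
      have h2 : HasDerivAt (fun t : ℝ => NormedSpace.exp ((-t) • (-I • A))) (-(-I • A)) 0 := by
        have h0 : HasDerivAt (fun t : ℝ => NormedSpace.exp (t • (-I • A))) (-I • A) (-0) := by
          simpa only [neg_zero] using h1
        have := HasDerivAt.scomp (h := fun t : ℝ => -t) (h' := -1) (0 : ℝ) h0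
          (hasDerivAt_neg (0 : ℝ))
        rw [neg_one_smul] at this
        exact this
      refine ((h1.mul_const X).mul h2).congr_deriv ?_
      simp [sub_eq_add_neg]
    have hclosed : IsClosed (drivableSpan G : Set (Matrix n n ℂ)) :=
      Submodule.closed_of_finiteDimensional _
    have hmem : ∀ t : ℝ, NormedSpace.exp (t • (-I • A)) * X *
        NormedSpace.exp ((-t) • (-I • A)) ∈ drivableSpan G := fun t => by
      rw [← exp_neg_I_smul, ← exp_neg_I_smul]
      exact conj_mem_drivableSpan h hX t
    have hlim := hd.tendsto_slope
    have := hclosed.mem_of_tendsto hlim (Filter.Eventually.of_forall fun t => by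
      rw [slope_def_module]
      exact Submodule.smul_mem _ _ (Submodule.sub_mem _ (hmem t) (hmem 0)))
    have h2 := Submodule.neg_mem _ this
    convert h2 using 1
    simp only [neg_smul, neg_mul, mul_neg, smul_mul_assoc, mul_smul_comm, smul_sub]
    abel
  | zero => simp
  | add X Y _ _ h1 h2 =>
    rw [add_mul, mul_add, add_sub_add_comm, smul_add]
    exact Submodule.add_mem _ h1 h2
  | smul r X _ h =>
    rw [mul_smul_comm, smul_mul_assoc, ← smul_sub, smul_comm]
    exact Submodule.smul_mem _ r h

/-- The product of the exponentials `exp(-i x_i A_i)` over a finite set of drivable Hamiltonians,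
taken in some order, is a map into `G ∩ SU(n)` whose derivative at `0` is `x ↦ -i ∑ x_i A_i`. -/
theorem exists_hasStrictFDerivAt_of_drivable {G : Submonoid (Matrix n n ℂ)}
    {ι : Type*} [Fintype ι] (A : ι → Matrix n n ℂ)
    (hA : ∀ i, A i ∈ drivable G) (s : Finset ι) :
    ∃ Φ : (ι → ℝ) → Matrix n n ℂ, (∀ x, Φ x ∈ G) ∧ (∀ x, Φ x ∈ specialUnitaryGroup n ℂ) ∧
      Φ 0 = 1 ∧ HasStrictFDerivAt Φ
        (∑ i ∈ s, (ContinuousLinearMap.proj (R := ℝ) (φ := fun _ : ι => ℝ) i).smulRight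
          (-I • A i)) 0 := by
  classical
  induction s using Finset.induction_on with
  | empty =>
    exact ⟨fun _ => 1, fun _ => G.one_mem, fun _ => Submonoid.one_mem _, rfl, by
      simpa using hasStrictFDerivAt_const (1 : Matrix n n ℂ) (0 : ι → ℝ)⟩
  | insert i s hi ih =>
    obtain ⟨Φ, h1, h2, h3, h4⟩ := ih
    have hexp : ∀ x : ι → ℝ, NormedSpace.exp (x i • (-I • A i)) =
        NormedSpace.exp (-(I * (x i : ℂ)) • A i) := fun x => (exp_neg_I_smul _ _).symm
    refine ⟨fun x => NormedSpace.exp (x i • (-I • A i)) * Φ x, fun x => ?_, fun x => ?_,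
      by simp [h3], ?_⟩
    · simp only [hexp]
      exact G.mul_mem ((hA i).2.2 _) (h1 x)
    · simp only [hexp]
      exact Submonoid.mul_mem _ (exp_neg_I_smul_mem_specialUnitaryGroup (hA i).1 (hA i).2.1 _) (h2 x)
    · have h5 : HasStrictFDerivAt (fun x : ι → ℝ => NormedSpace.exp (x i • (-I • A i)))
          ((ContinuousLinearMap.proj (R := ℝ) (φ := fun _ : ι => ℝ) i).smulRight (-I • A i)) 0 := by
        have := (hasStrictDerivAt_exp_real_smul (-I • A i)).hasStrictFDerivAt
        have := HasStrictFDerivAt.comp (0 : ι → ℝ) (f := fun x : ι → ℝ => x i)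
          (by simpa only [Pi.zero_apply] using this)
          (ContinuousLinearMap.proj (R := ℝ) (φ := fun _ : ι => ℝ) i).hasStrictFDerivAt
        refine this.congr_fderiv ?_
        ext x : 1
        simp
      refine (h5.mul' h4).congr_fderiv ?_
      rw [Finset.sum_insert hi, h3]
      ext x : 1
      simp [add_comm]

/-- If the drivable Hamiltonians span the traceless Hermitian matrices, then `G` contains a
neighbourhood of `1` in `SU(n)`. The map `(x, c, M) ↦ Φ(x) e^{ic} (1 + M + M*)` into all matrices is
locally surjective at `0`, and a value in `SU(n)` with small `c` and `M` has `M + M* = 0` and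
`c = 0`, so that it equals `Φ(x) ∈ G`. -/
theorem eventually_mem_of_traceless_mem_drivableSpan [Nonempty n] {G : Submonoid (Matrix n n ℂ)}
    (hG : ∀ A : Matrix n n ℂ, A.IsHermitian → A.trace = 0 → A ∈ drivableSpan G) :
    ∀ᶠ W in nhds (1 : Matrix n n ℂ), W ∈ specialUnitaryGroup n ℂ → W ∈ G := by
  classical
  obtain ⟨t, htS, -, htspan, -⟩ := Submodule.exists_finset_span_eq_linearIndepOn ℝ (drivable G)
  obtain ⟨Φ, hΦG, hΦSU, hΦ0, hΦd⟩ := exists_hasStrictFDerivAt_of_drivable (ι := t)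
    (fun A => (A : Matrix n n ℂ)) (fun A => htS A.2) Finset.univ
  let P : Matrix n n ℂ →L[ℝ] Matrix n n ℂ :=
    ContinuousLinearMap.id ℝ _ + (starL' ℝ : Matrix n n ℂ ≃L[ℝ] Matrix n n ℂ).toContinuousLinearMap
  have hP : ∀ M, P M = M + star M := fun M => rfl
  let E := (t → ℝ) × ℝ × Matrix n n ℂ
  let Ψ : E → Matrix n n ℂ := fun p =>
    Φ p.1 * (NormedSpace.exp (p.2.1 • (I • (1 : Matrix n n ℂ))) * (1 + P p.2.2))
  have hexpI : ∀ c : ℝ, NormedSpace.exp (c • (I • (1 : Matrix n n ℂ))) =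
      Complex.exp (I * c) • (1 : Matrix n n ℂ) := fun c => by
    have h : c • (I • (1 : Matrix n n ℂ)) = diagonal fun _ => I * c := by
      rw [← diagonal_one, ← diagonal_smul, ← diagonal_smul]
      congr 1; ext i; simp [mul_comm]
    rw [h, Matrix.exp_diagonal, ← diagonal_one, ← diagonal_smul]
    congr 1; ext i
    simp [Pi.coe_exp, Complex.exp_eq_exp_ℂ]
  let D1 : E →L[ℝ] Matrix n n ℂ :=
    (∑ i : t, (ContinuousLinearMap.proj (R := ℝ) (φ := fun _ : t => ℝ) i).smulRight
      (-I • (i : Matrix n n ℂ))) ∘L ContinuousLinearMap.fst ℝ _ _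
  let D2 : E →L[ℝ] Matrix n n ℂ :=
    ((ContinuousLinearMap.fst ℝ ℝ (Matrix n n ℂ)).smulRight (I • (1 : Matrix n n ℂ))) ∘L
      ContinuousLinearMap.snd ℝ (t → ℝ) _
  let D3 : E →L[ℝ] Matrix n n ℂ :=
    P ∘L (ContinuousLinearMap.snd ℝ ℝ (Matrix n n ℂ)) ∘L ContinuousLinearMap.snd ℝ (t → ℝ) _
  have hΨd : HasStrictFDerivAt Ψ (D1 + D2 + D3) 0 := by
    have e1 : HasStrictFDerivAt (fun p : E => Φ p.1) D1 0 :=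
      HasStrictFDerivAt.comp (0 : E) (f := fun p : E => p.1) hΦd
        (ContinuousLinearMap.fst ℝ (t → ℝ) (ℝ × Matrix n n ℂ)).hasStrictFDerivAt
    have e2 : HasStrictFDerivAt (fun p : E => NormedSpace.exp (p.2.1 • (I • (1 : Matrix n n ℂ))))
        D2 0 := by
      have := (hasStrictDerivAt_exp_real_smul (I • (1 : Matrix n n ℂ))).hasStrictFDerivAt
      have := HasStrictFDerivAt.comp (0 : E) (f := fun p : E => p.2.1)
        (by exact this) ((ContinuousLinearMap.fst ℝ ℝ (Matrix n n ℂ)) ∘L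
          ContinuousLinearMap.snd ℝ (t → ℝ) _).hasStrictFDerivAt
      refine this.congr_fderiv ?_
      exact ContinuousLinearMap.ext fun p => rfl
    have e3 : HasStrictFDerivAt (fun p : E => 1 + P p.2.2) D3 0 :=
      (D3.hasStrictFDerivAt (x := (0 : E))).const_add 1
    refine (e1.mul' (e2.mul' e3)).congr_fderiv ?_
    refine ContinuousLinearMap.ext fun p => ?_
    change Φ 0 * (NormedSpace.exp ((0 : ℝ) • (I • (1 : Matrix n n ℂ))) * D3 p + D2 p * (1 + P 0)) +
      D1 p * (NormedSpace.exp ((0 : ℝ) • (I • (1 : Matrix n n ℂ))) * (1 + P 0)) =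
      D1 p + D2 p + D3 p
    rw [hΦ0, map_zero, zero_smul, NormedSpace.exp_zero]
    simp only [one_mul, mul_one, add_zero]
    abel
  have hsurj : (D1 + D2 + D3).range = ⊤ := by
    rw [LinearMap.range_eq_top]
    intro Z
    -- `Z` is its Hermitian part plus `iK`, and `K` is a scalar `κ` plus a traceless matrix.
    set K : Matrix n n ℂ := (-I / 2) • (Z - star Z) with hK
    have hKh : K.IsHermitian := by
      rw [IsHermitian, ← star_eq_conjTranspose, hK, star_smul, star_sub, star_star,
        ← neg_sub Z, smul_neg, ← neg_smul]
      congr 1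
      simp
      ring
    set κ : ℝ := K.trace.re / Fintype.card n with hκ
    have htr : ((K.trace.re : ℝ) : ℂ) = K.trace := by
      apply Complex.conj_eq_iff_re.1
      change star _ = _
      rw [← trace_conjTranspose, hKh.eq]
    have hK0 : (κ • (1 : Matrix n n ℂ) - K) ∈ drivableSpan G := by
      apply hG
      · refine IsHermitian.sub ?_ hKh
        simp [IsHermitian, conjTranspose_smul]
      · rw [trace_sub, trace_smul, trace_one, ← htr, hκ]
        have : (Fintype.card n : ℂ) ≠ 0 := by simp
        simp
    rw [drivableSpan, ← htspan, Submodule.mem_span_finset'] at hK0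
    obtain ⟨x, hx⟩ := hK0
    refine ⟨(x, κ, (1 / 2 : ℝ) • Z), ?_⟩
    have hD1 : D1 (x, κ, (1 / 2 : ℝ) • Z) = -I • (κ • (1 : Matrix n n ℂ) - K) := by
      change (∑ i : t, (ContinuousLinearMap.proj (R := ℝ) (φ := fun _ : t => ℝ) i).smulRight
        (-I • (i : Matrix n n ℂ))) x = _
      rw [← hx, Finset.smul_sum]
      simp [smul_comm I]
    have hD2 : D2 (x, κ, (1 / 2 : ℝ) • Z) = κ • (I • 1) := rfl
    have hD3 : D3 (x, κ, (1 / 2 : ℝ) • Z) = (1 / 2 : ℝ) • Z + star ((1 / 2 : ℝ) • Z) := rfl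
    change D1 _ + D2 _ + D3 _ = Z
    rw [hD1, hD2, hD3, hK]
    ext i j
    simp
    ring_nf
    simp
    ring
  have hmap := hΨd.map_nhds_eq_of_surj hsurj
  have hΨ0 : Ψ 0 = 1 := by simp [Ψ, hΦ0]
  rw [hΨ0] at hmap
  rw [← hmap, Filter.eventually_map]
  have hc : ∀ᶠ p in nhds (0 : E), |p.2.1| * Fintype.card n < 2 * Real.pi := by
    have : Continuous fun p : E => |p.2.1| * (Fintype.card n : ℝ) := by fun_prop
    refine this.continuousAt.eventually_lt continuousAt_const ?_
    simp [Real.pi_pos]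
  have hu : ∀ᶠ p in nhds (0 : E), IsUnit (2 + P p.2.2) := by
    have hcont : Continuous fun p : E => 2 + P p.2.2 := by fun_prop
    refine hcont.continuousAt.eventually (Units.isOpen.mem_nhds ?_)
    have h0 : 2 + P (0 : E).2.2 = (2 : Matrix n n ℂ) := by
      rw [show (0 : E).2.2 = 0 from rfl, map_zero, add_zero]
    change IsUnit (2 + P (0 : E).2.2)
    rw [h0]
    have : (2 : Matrix n n ℂ) = algebraMap ℂ _ 2 := (map_ofNat (algebraMap ℂ _) 2).symm
    rw [this]
    exact (IsUnit.mk0 (2 : ℂ) two_ne_zero).map _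
  filter_upwards [hc, hu] with p hc hu hW
  obtain ⟨x, c, M⟩ := p
  simp only at hc hu
  change Φ x * (NormedSpace.exp (c • (I • (1 : Matrix n n ℂ))) * (1 + P M)) ∈ G
  change Φ x * (NormedSpace.exp (c • (I • (1 : Matrix n n ℂ))) * (1 + P M)) ∈ _ at hW
  set R := NormedSpace.exp (c • (I • (1 : Matrix n n ℂ))) * (1 + P M) with hR
  have hRSU : R ∈ specialUnitaryGroup n ℂ := by
    have h1 := hΦSU x
    have h2 : star (Φ x) ∈ specialUnitaryGroup n ℂ :=
      (star (⟨Φ x, h1⟩ : specialUnitaryGroup n ℂ)).2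
    have h3 := Submonoid.mul_mem _ h2 hW
    rwa [← mul_assoc, mem_unitaryGroup_iff'.1 (mem_specialUnitaryGroup_iff.1 h1).1, one_mul] at h3
  rw [hexpI, smul_mul_assoc, one_mul] at hR
  have hPs : star (P M) = P M := by rw [hP, star_add, star_star, add_comm]
  have hPM : P M = 0 := by
    have h1 := mem_unitaryGroup_iff.1 (mem_specialUnitaryGroup_iff.1 hRSU).1
    rw [hR, star_smul, star_add, star_one, hPs, smul_mul_smul_comm] at h1
    have h2 : Complex.exp (I * c) * star (Complex.exp (I * c)) = 1 := by
      change _ * (starRingEnd ℂ) _ = 1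
      rw [← Complex.exp_conj, ← Complex.exp_add]
      simp
    rw [h2, one_smul] at h1
    -- A unitary Hermitian `1 + P M` squares to `1`.
    have h3 : (2 + P M) * P M = 0 := by
      have : (2 + P M) * P M = (1 + P M) * (1 + P M) - 1 := by noncomm_ring
      rw [this, h1, sub_self]
    exact (hu.mul_right_eq_zero).1 h3
  have hc0 : c = 0 := by
    have h1 := (mem_specialUnitaryGroup_iff.1 hRSU).2
    rw [hR, hPM, add_zero, det_smul, det_one, mul_one, ← Complex.exp_nat_mul,
      Complex.exp_eq_one_iff] at h1
    obtain ⟨m, hm⟩ := h1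
    have h2 : (Fintype.card n : ℝ) * c = m * (2 * Real.pi) := by
      have : ((Fintype.card n : ℂ) * c) = m * (2 * Real.pi) := by
        apply mul_left_cancel₀ I_ne_zero
        linear_combination hm
      exact_mod_cast this
    have h3 : |(m : ℝ)| < 1 := by
      have h4 : |(Fintype.card n : ℝ) * c| = |(m : ℝ)| * (2 * Real.pi) := by
        rw [h2, abs_mul, abs_of_pos (by positivity : 0 < 2 * Real.pi)]
      rw [abs_mul, Nat.abs_cast, mul_comm] at h4
      rw [h4] at hc
      nlinarith [Real.pi_pos]
    have h5 : m = 0 := by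
      rw [← Int.abs_lt_one_iff]
      exact_mod_cast h3
    rw [h5] at h2
    simpa using h2
  have : R = 1 := by rw [hR, hPM, hc0]; simp
  rw [this, mul_one]
  exact hΦG x

/-- Every `W ∈ SU(n)` is a power of an element of `SU(n)` close to `1`, namely of `exp(iK / m)` where
`W = exp(iK)` with `K` traceless Hermitian; so a neighbourhood of `1` generates `SU(n)`. -/
theorem specialUnitaryGroup_le_of_traceless_mem_drivableSpan [Nonempty n]
    {G : Submonoid (Matrix n n ℂ)}
    (hG : ∀ A : Matrix n n ℂ, A.IsHermitian → A.trace = 0 → A ∈ drivableSpan G) :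
    specialUnitaryGroup n ℂ ≤ G := by
  intro W hW
  obtain ⟨K, hK, hK0, rfl⟩ := exists_traceless_isHermitian_exp_eq hW
  have hlim : Filter.Tendsto (fun m : ℕ => NormedSpace.exp ((1 / ((m : ℝ) + 1)) • (I • K)))
      Filter.atTop (nhds 1) := by
    have h1 := (hasStrictDerivAt_exp_real_smul (I • K)).hasDerivAt.continuousAt
    have h2 := h1.tendsto.comp (tendsto_one_div_add_atTop_nhds_zero_nat (𝕜 := ℝ))
    simpa [Function.comp_def] using h2
  obtain ⟨m, hm⟩ := (hlim.eventually (eventually_mem_of_traceless_mem_drivableSpan hG)).exists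
  have hSU : NormedSpace.exp ((1 / ((m : ℝ) + 1)) • (I • K)) ∈ specialUnitaryGroup n ℂ := by
    have := exp_neg_I_smul_mem_specialUnitaryGroup hK hK0 (-(1 / ((m : ℝ) + 1)))
    rw [exp_neg_I_smul] at this
    simpa using this
  have hpow := Matrix.exp_nsmul (m + 1) ((1 / ((m : ℝ) + 1)) • (I • K))
  have heq : (m + 1) • ((1 / ((m : ℝ) + 1)) • (I • K)) = I • K := by
    rw [← Nat.cast_smul_eq_nsmul ℝ, smul_smul]
    have : (m : ℝ) + 1 ≠ 0 := by positivity
    push_cast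
    rw [mul_one_div_cancel this, one_smul]
  rw [heq] at hpow
  rw [hpow]
  exact G.pow_mem (hm hSU) _

variable {N : ℕ}

/-! ### Pauli strings -/

/-- The tensor product `A 0 ⊗ A 1 ⊗ ⋯` of one-qubit operators, in the computational basis. -/
def tensorOp (A : Fin N → Matrix (Fin 2) (Fin 2) ℂ) : QubitOp N :=
  of fun x y => ∏ k, A k (x k) (y k)

theorem tensorOp_mul (A B : Fin N → Matrix (Fin 2) (Fin 2) ℂ) :
    tensorOp A * tensorOp B = tensorOp (A * B) := by
  ext x y
  simp only [tensorOp, mul_apply, of_apply, Pi.mul_apply, ← Finset.prod_mul_distrib]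
  rw [Finset.prod_univ_sum, Fintype.piFinset_univ]

theorem tensorOp_one : tensorOp (1 : Fin N → Matrix (Fin 2) (Fin 2) ℂ) = 1 := by
  ext x y
  simp [tensorOp, one_apply, Finset.prod_ite_zero, funext_iff]

theorem tensorOp_conjTranspose (A : Fin N → Matrix (Fin 2) (Fin 2) ℂ) :
    (tensorOp A)ᴴ = tensorOp fun k => (A k)ᴴ := by
  ext x y
  simp [tensorOp, conjTranspose_apply]

theorem trace_tensorOp (A : Fin N → Matrix (Fin 2) (Fin 2) ℂ) :
    (tensorOp A).trace = ∏ k, (A k).trace := by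
  simp only [trace, tensorOp, diag_apply, of_apply]
  rw [Finset.prod_univ_sum, Fintype.piFinset_univ]

theorem tensorOp_update_apply (A : Fin N → Matrix (Fin 2) (Fin 2) ℂ) (j : Fin N)
    (X : Matrix (Fin 2) (Fin 2) ℂ) (x y : Fin N → Fin 2) :
    tensorOp (Function.update A j X) x y =
      X (x j) (y j) * ∏ k ∈ Finset.univ.erase j, A k (x k) (y k) := by
  rw [tensorOp, of_apply, ← Finset.mul_prod_erase _ _ (Finset.mem_univ j), Function.update_self]
  congr 1
  refine Finset.prod_congr rfl fun k hk => ?_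
  rw [Function.update_of_ne (Finset.ne_of_mem_erase hk)]

/-- The tensor product of the operators `A`, as a linear function of its `j`-th factor. -/
def tensorOpUpdate (A : Fin N → Matrix (Fin 2) (Fin 2) ℂ) (j : Fin N) :
    Matrix (Fin 2) (Fin 2) ℂ →ₗ[ℂ] QubitOp N where
  toFun X := tensorOp (Function.update A j X)
  map_add' X Y := by
    ext x y
    simp only [Matrix.add_apply, tensorOp_update_apply, add_mul]
  map_smul' c X := by
    ext x y
    simp only [Matrix.smul_apply, tensorOp_update_apply, smul_mul_assoc, RingHom.id_apply]

/-- If two tensor products commute at every qubit except `j`, their commutator is taken at `j`. -/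
theorem tensorOp_commutator (A B : Fin N → Matrix (Fin 2) (Fin 2) ℂ) (j : Fin N)
    (h : ∀ l, l ≠ j → A l * B l = B l * A l) :
    tensorOp A * tensorOp B - tensorOp B * tensorOp A =
      tensorOp (Function.update (A * B) j (A j * B j - B j * A j)) := by
  rw [tensorOp_mul, tensorOp_mul]
  change _ = tensorOpUpdate (A * B) j _
  rw [map_sub]
  congr 1
  · change _ = tensorOp (Function.update (A * B) j ((A * B) j))
    rw [Function.update_eq_self]
  · change _ = tensorOp (Function.update (A * B) j ((B * A) j))
    congr 1
    ext1 l
    rcases eq_or_ne l j with rfl | hl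
    · rw [Function.update_self]
    · rw [Function.update_of_ne hl]
      exact (h l hl).symm

/-- The identity (label `none`) and the three Pauli matrices (labels `some a`). -/
def pauliOp : Option (Fin 3) → Matrix (Fin 2) (Fin 2) ℂ
  | none => 1
  | some a => pauli a

/-- The Pauli string with label `f k` at the qubit `k`. -/
def pauliString (f : Fin N → Option (Fin 3)) : QubitOp N :=
  tensorOp fun k => pauliOp (f k)

theorem pauli_conjTranspose (a : Fin 3) : (pauli a)ᴴ = pauli a := by
  fin_cases a <;> ext i j <;> fin_cases i <;> fin_cases j <;> simp [pauli]

theorem pauli_trace (a : Fin 3) : (pauli a).trace = 0 := by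
  fin_cases a <;> simp [pauli, trace]

theorem pauli_mul_self (a : Fin 3) : pauli a * pauli a = 1 := by
  fin_cases a <;> ext i j <;> fin_cases i <;> fin_cases j <;> simp [pauli, mul_apply]

theorem pauli_commutator {a b c : Fin 3} (hab : a ≠ b) (hac : a ≠ c) (hbc : b ≠ c) :
    ∃ s : ℝ, s ≠ 0 ∧ I • (pauli a * pauli b - pauli b * pauli a) = (s : ℂ) • pauli c := by
  fin_cases a <;> fin_cases b <;> fin_cases c <;> simp at hab hac hbc <;>
  first
  | (refine ⟨2, by norm_num, ?_⟩
     ext i j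
     fin_cases i <;> fin_cases j <;> simp [pauli] <;> ring_nf <;> simp
     done)
  | (refine ⟨-2, by norm_num, ?_⟩
     ext i j
     fin_cases i <;> fin_cases j <;> simp [pauli] <;> ring_nf <;> simp)

theorem pauli_conj_of_ne {a b : Fin 3} (hab : a ≠ b) :
    pauli a * pauli b * pauli a = -pauli b := by
  fin_cases a <;> fin_cases b <;> simp at hab <;> ext i j <;> fin_cases i <;> fin_cases j <;>
    simp [pauli, mul_apply]

theorem pauliString_isHermitian (f : Fin N → Option (Fin 3)) : (pauliString f).IsHermitian := by
  rw [IsHermitian, pauliString, tensorOp_conjTranspose]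
  congr 1
  ext1 k
  rcases f k with _ | a
  · exact conjTranspose_one
  · exact pauli_conjTranspose a

theorem pauliString_trace {f : Fin N → Option (Fin 3)} (hf : f ≠ fun _ => none) :
    (pauliString f).trace = 0 := by
  obtain ⟨k, hk⟩ := Function.ne_iff.1 hf
  obtain ⟨a, ha⟩ := Option.ne_none_iff_exists'.1 hk
  rw [pauliString, trace_tensorOp]
  refine Finset.prod_eq_zero (Finset.mem_univ k) ?_
  rw [ha]
  exact pauli_trace a

theorem pauliString_none : pauliString (fun _ : Fin N => none) = 1 := tensorOp_one

theorem pauliAt_eq_tensorOp (a : Fin 3) (k : Fin N) :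
    pauliAt a k = tensorOp (Function.update 1 k (pauli a)) := by
  ext x y
  rw [tensorOp_update_apply]
  simp only [pauliAt, of_apply, Pi.one_apply, one_apply, Finset.prod_ite_zero, Finset.prod_const_one,
    Finset.mem_erase, Finset.mem_univ, and_true]
  split_ifs <;> simp

theorem pauliAt_eq_pauliString (a : Fin 3) (k : Fin N) :
    pauliAt a k = pauliString (Function.update (fun _ => none) k (some a)) := by
  rw [pauliAt_eq_tensorOp, pauliString]
  congr 1
  ext1 l
  rcases eq_or_ne l k with rfl | hl
  · simp [pauliOp]
  · simp [hl, pauliOp]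

theorem pauliAt_mul_pauliAt {i j : Fin N} (hij : i ≠ j) (a b : Fin 3) :
    pauliAt a i * pauliAt b j =
      pauliString (Function.update (Function.update (fun _ => none) i (some a)) j (some b)) := by
  rw [pauliAt_eq_pauliString, pauliAt_eq_pauliString, pauliString, pauliString, tensorOp_mul,
    pauliString]
  congr 1
  ext1 l
  rcases eq_or_ne l j with rfl | hl
  · simp [pauliOp, hij.symm]
  · rcases eq_or_ne l i with rfl | hl'
    · simp [pauliOp, hl]
    · simp [hl, hl', pauliOp]

theorem span_pauliOp (X : Matrix (Fin 2) (Fin 2) ℂ) :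
    ∃ c : Option (Fin 3) → ℂ, X = ∑ o, c o • pauliOp o := by
  refine ⟨fun o => o.elim ((X 0 0 + X 1 1) / 2)
    ![(X 0 1 + X 1 0) / 2, I * (X 0 1 - X 1 0) / 2, (X 0 0 - X 1 1) / 2], ?_⟩
  rw [Fintype.sum_option, Fin.sum_univ_three]
  ext i j
  fin_cases i <;> fin_cases j <;> simp [pauliOp, pauli] <;> ring_nf <;> simp <;> ring

/-- The Pauli strings span all operators, because the tensor products of matrix units expand into
them. -/
theorem exists_eq_sum_pauliString (A : QubitOp N) :
    ∃ c : (Fin N → Option (Fin 3)) → ℂ, A = ∑ f, c f • pauliString f := by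
  suffices h : A ∈ Submodule.span ℂ (Set.range (pauliString (N := N))) by
    obtain ⟨c, hc⟩ := (Submodule.mem_span_range_iff_exists_fun ℂ).1 h
    exact ⟨c, hc.symm⟩
  rw [matrix_eq_sum_single A]
  refine Submodule.sum_mem _ fun x _ => Submodule.sum_mem _ fun y _ => ?_
  have hs : Matrix.single x y (A x y) =
      A x y • tensorOp fun k => Matrix.single (x k) (y k) (1 : ℂ) := by
    ext x' y'
    simp only [single_apply, tensorOp, Matrix.smul_apply, of_apply, Finset.prod_ite_zero,
      Finset.prod_const_one, Finset.mem_univ, true_implies, funext_iff, forall_and]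
    split_ifs <;> simp
  rw [hs]
  refine Submodule.smul_mem _ _ ?_
  choose c hc using fun k : Fin N => span_pauliOp (Matrix.single (x k) (y k) (1 : ℂ))
  have : (tensorOp fun k => Matrix.single (x k) (y k) (1 : ℂ)) =
      ∑ f : Fin N → Option (Fin 3), (∏ k, c k (f k)) • pauliString f := by
    simp only [hc]
    ext x' y'
    simp only [tensorOp, of_apply, Matrix.sum_apply, Matrix.smul_apply, pauliString, smul_eq_mul]
    rw [Finset.prod_univ_sum, Fintype.piFinset_univ]
    simp only [Finset.prod_mul_distrib]
  rw [this]
  exact Submodule.sum_mem _ fun f _ => Submodule.smul_mem _ _ (Submodule.subset_span ⟨f, rfl⟩)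

/-- Every traceless Hermitian operator is a real combination of the nonidentity Pauli strings. -/
theorem traceless_isHermitian_mem {L : Submodule ℝ (QubitOp N)}
    (hL : ∀ f : Fin N → Option (Fin 3), f ≠ (fun _ => none) → pauliString f ∈ L)
    {A : QubitOp N} (hA : A.IsHermitian) (h0 : A.trace = 0) : A ∈ L := by
  classical
  obtain ⟨c, hc⟩ := exists_eq_sum_pauliString A
  have hre : A = ∑ f, (c f).re • pauliString f := by
    -- Averaging the expansions of `A` and `Aᴴ` makes the coefficients real.
    have h1 : A = ∑ f, (starRingEnd ℂ (c f)) • pauliString f := by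
      conv_lhs => rw [← hA.eq, hc, conjTranspose_sum]
      refine Finset.sum_congr rfl fun f _ => ?_
      rw [conjTranspose_smul, (pauliString_isHermitian f).eq]
      rfl
    have h2 : (2 : ℝ) • A = (2 : ℝ) • ∑ f, (c f).re • pauliString f := by
      conv_lhs => rw [two_smul]
      nth_rewrite 1 [hc]
      rw [h1, ← Finset.sum_add_distrib, Finset.smul_sum]
      refine Finset.sum_congr rfl fun f _ => ?_
      rw [← add_smul, Complex.add_conj, smul_smul, ← Complex.coe_smul]
    exact smul_right_injective _ (two_ne_zero) h2
  have hc0 : (c fun _ => none).re = 0 := by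
    rw [hre, trace_sum, Finset.sum_eq_single (fun _ => none)] at h0
    · rw [pauliString_none, trace_smul, trace_one] at h0
      simpa using h0
    · intro f _ hf
      rw [trace_smul, pauliString_trace hf, smul_zero]
    · simp
  rw [hre]
  refine Submodule.sum_mem _ fun f _ => ?_
  by_cases hf : f = fun _ => none
  · rw [hf, hc0, zero_smul]
    exact L.zero_mem
  · exact L.smul_mem _ (hL f hf)

/-! ### Local fields and the interaction in bracket-closed spaces -/

theorem localField_add (k : Fin N) (v w : Fin 3 → ℝ) :
    localField k (v + w) = localField k v + localField k w := by
  simp [localField, add_smul, Finset.sum_add_distrib]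

theorem localField_smul (k : Fin N) (r : ℝ) (v : Fin 3 → ℝ) :
    localField k (r • v) = r • localField k v := by
  simp [localField, Finset.smul_sum, mul_smul]

/-- `localField k` as a real-linear map. -/
def localFieldLinear (k : Fin N) : (Fin 3 → ℝ) →ₗ[ℝ] QubitOp N where
  toFun := localField k
  map_add' := localField_add k
  map_smul' := localField_smul k

theorem localField_single (k : Fin N) (a : Fin 3) :
    localField k (Pi.single a 1) = pauliAt a k := by
  rw [localField, Finset.sum_eq_single a]
  · simp
  · intro b _ hb
    simp [hb]
  · simp

theorem localField_eq_tensorOp (k : Fin N) (v : Fin 3 → ℝ) :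
    localField k v = tensorOp (Function.update 1 k (∑ a, (v a : ℂ) • pauli a)) := by
  change _ = tensorOpUpdate 1 k _
  rw [map_sum, localField]
  refine Finset.sum_congr rfl fun a _ => ?_
  rw [map_smul, pauliAt_eq_tensorOp]
  rfl

theorem sum_pauli_commutator (v w : Fin 3 → ℝ) :
    I • ((∑ a, (v a : ℂ) • pauli a) * (∑ a, (w a : ℂ) • pauli a) -
      (∑ a, (w a : ℂ) • pauli a) * ∑ a, (v a : ℂ) • pauli a) =
      (-2 : ℝ) • ∑ a, ((crossProduct v w) a : ℂ) • pauli a := by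
  simp only [Fin.sum_univ_three, cross_apply]
  ext i j
  fin_cases i <;> fin_cases j <;> simp [pauli] <;> ring_nf <;> simp <;> ring

theorem localField_commutator (k : Fin N) (v w : Fin 3 → ℝ) :
    I • (localField k v * localField k w - localField k w * localField k v) =
      (-2 : ℝ) • localField k (crossProduct v w) := by
  simp only [localField_eq_tensorOp]
  rw [tensorOp_commutator _ _ k (fun l hl => by simp [hl])]
  simp only [Function.update_self]
  have h1 : ((Function.update (1 : Fin N → Matrix (Fin 2) (Fin 2) ℂ) k (∑ a, (v a : ℂ) • pauli a)) *
      Function.update (1 : Fin N → Matrix (Fin 2) (Fin 2) ℂ) k (∑ a, (w a : ℂ) • pauli a)) =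
      Function.update (1 : Fin N → Matrix (Fin 2) (Fin 2) ℂ) k
      ((∑ a, (v a : ℂ) • pauli a) * ∑ a, (w a : ℂ) • pauli a) := by
    ext1 l
    rcases eq_or_ne l k with rfl | hl
    · simp
    · simp [hl]
  rw [h1, Function.update_idem]
  change I • tensorOpUpdate 1 k _ = (-2 : ℝ) • tensorOpUpdate 1 k _
  rw [← map_smul, sum_pauli_commutator, ← Complex.coe_smul, map_smul, ← Complex.coe_smul]

theorem localField_mul_comm {j k : Fin N} (hjk : j ≠ k) (v w : Fin 3 → ℝ) :
    localField k v * localField j w = localField j w * localField k v := by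
  rw [localField_eq_tensorOp, localField_eq_tensorOp, tensorOp_mul, tensorOp_mul]
  congr 1
  ext1 l
  rcases eq_or_ne l k with rfl | hl
  · simp [hjk.symm]
  · simp [hl]

/-- If `v × w ≠ 0`, then `v`, `v × w` and `v × (v × w)` are nonzero and orthogonal, so they span
`ℝ³`. -/
theorem submodule_eq_top_of_cross_mem {L : Submodule ℝ (Fin 3 → ℝ)} {v w : Fin 3 → ℝ}
    (hv : v ∈ L) (hvw : crossProduct v w ∈ L) (hL : crossProduct v (crossProduct v w) ∈ L)
    (h0 : crossProduct v w ≠ 0) : L = ⊤ := by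
  rw [eq_top_iff]
  intro u _
  have hv0 : v ≠ 0 := by
    rintro rfl
    simp at h0
  have hpos : ∀ x : Fin 3 → ℝ, x ≠ 0 → x ⬝ᵥ x ≠ 0 := fun x hx h => hx (dotProduct_self_eq_zero.1 h)
  set m := crossProduct v w with hm
  have key : ((v ⬝ᵥ v) * (m ⬝ᵥ m)) • u = ((m ⬝ᵥ m) * (u ⬝ᵥ v)) • v + ((v ⬝ᵥ v) * (u ⬝ᵥ m)) • m +
      (u ⬝ᵥ crossProduct v m) • crossProduct v m := by
    rw [hm]
    ext i
    simp only [Pi.add_apply, Pi.smul_apply, smul_eq_mul, cross_apply, dotProduct,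
      Fin.sum_univ_three]
    fin_cases i <;> simp <;> ring
  have hmem : ((v ⬝ᵥ v) * (m ⬝ᵥ m)) • u ∈ L := by
    rw [key]
    exact L.add_mem (L.add_mem (L.smul_mem _ hv) (L.smul_mem _ hvw)) (L.smul_mem _ hL)
  exact (L.smul_mem_iff (mul_ne_zero (hpos v hv0) (hpos m h0))).1 hmem

/-- A bracket-closed space that contains a field `d` on the qubit `k` and a sum of local fields `b`
contains every field on `k` when `d` and `b k` are independent: bracketing with `d` discards the
fields on the other qubits and generates `d × b k`, then `d × (d × b k)`. -/
theorem localField_mem_of_switch {L : Submodule ℝ (QubitOp N)}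
    (hL : ∀ A ∈ L, ∀ B ∈ L, I • (A * B - B * A) ∈ L) (b : Fin N → Fin 3 → ℝ)
    (hb : ∑ k, localField k (b k) ∈ L) {k : Fin N} {d : Fin 3 → ℝ} (hd : localField k d ∈ L)
    (hdb : crossProduct d (b k) ≠ 0) (v : Fin 3 → ℝ) : localField k v ∈ L := by
  have hcross : ∀ v w : Fin 3 → ℝ,
      I • (localField k v * localField k w - localField k w * localField k v) ∈ L →
      localField k (crossProduct v w) ∈ L := fun v w h => by
    rw [localField_commutator] at h
    exact (L.smul_mem_iff (by norm_num)).1 h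
  have h1 : localField k (crossProduct d (b k)) ∈ L := by
    apply hcross
    have := hL _ hd _ hb
    rw [Finset.mul_sum, Finset.sum_mul, ← Finset.sum_sub_distrib,
      Finset.sum_eq_single k] at this
    · exact this
    · intro j _ hj
      rw [localField_mul_comm hj, sub_self]
    · simp
  have h2 := hcross _ _ (hL _ hd _ h1)
  have := submodule_eq_top_of_cross_mem (L := L.comap (localFieldLinear k)) hd h1 h2 hdb
  exact (this ▸ Submodule.mem_top : v ∈ L.comap (localFieldLinear k))

/-- Conjugation by an involution `S` is `X ↦ X - ½ [S, [S, X]]`. -/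
theorem mul_mul_mem_of_mem {L : Submodule ℝ (QubitOp N)}
    (hL : ∀ A ∈ L, ∀ B ∈ L, I • (A * B - B * A) ∈ L) {S X : QubitOp N} (hS : S ∈ L)
    (hSS : S * S = 1) (hX : X ∈ L) : S * X * S ∈ L := by
  have h := hL _ hS _ (hL _ hS _ hX)
  have h2 : S * X * S = X + (1 / 2 : ℝ) •
      (I • (S * (I • (S * X - X * S)) - (I • (S * X - X * S)) * S)) := by
    have h3 : S * (S * X - X * S) - (S * X - X * S) * S = (2 : ℝ) • X - (2 : ℝ) • (S * X * S) := by
      rw [mul_sub, sub_mul, ← mul_assoc, hSS, mul_assoc X S S, hSS, two_smul, two_smul]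
      noncomm_ring
    rw [mul_smul_comm, smul_mul_assoc, ← smul_sub, h3, smul_smul, I_mul_I, neg_one_smul, neg_sub,
      ← smul_sub, smul_smul]
    norm_num
  rw [h2]
  exact L.add_mem hX (L.smul_mem _ h)

/-- The projection onto the Pauli strings with `σ_a` at the qubit `k`. Adding the conjugate by `σ_a`
keeps the labels `1` and `σ_a`; subtracting then the conjugate by another Pauli matrix, here
`σ_{a+1}` with the index taken modulo `3`, removes the label `1`. -/
noncomputable def pauliProj (k : Fin N) (a : Fin 3) : QubitOp N →ₗ[ℂ] QubitOp N :=
  ((1 / 4 : ℝ) : ℂ) • (LinearMap.id - LinearMap.mulLeft ℂ (pauliAt (a + 1) k) ∘ₗ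
      LinearMap.mulRight ℂ (pauliAt (a + 1) k)) ∘ₗ
    (LinearMap.id + LinearMap.mulLeft ℂ (pauliAt a k) ∘ₗ LinearMap.mulRight ℂ (pauliAt a k))

theorem pauliAt_mul_self (a : Fin 3) (k : Fin N) : pauliAt a k * pauliAt a k = 1 := by
  rw [pauliAt_eq_tensorOp, tensorOp_mul, ← tensorOp_one]
  congr 1
  ext1 l
  rcases eq_or_ne l k with rfl | hl
  · simp [pauli_mul_self]
  · simp [hl]

theorem pauliProj_mem {L : Submodule ℝ (QubitOp N)}
    (hL : ∀ A ∈ L, ∀ B ∈ L, I • (A * B - B * A) ∈ L) {k : Fin N}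
    (hk : ∀ a, pauliAt a k ∈ L) (a : Fin 3) {X : QubitOp N} (hX : X ∈ L) :
    pauliProj k a X ∈ L := by
  have hc : ∀ b, ∀ Y ∈ L, pauliAt b k * (Y * pauliAt b k) ∈ L := fun b Y hY => by
    rw [← mul_assoc]
    exact mul_mul_mem_of_mem hL (hk b) (pauliAt_mul_self b k) hY
  have h1 : X + pauliAt a k * (X * pauliAt a k) ∈ L := L.add_mem hX (hc a X hX)
  have h2 := L.sub_mem h1 (hc (a + 1) _ h1)
  have h3 := L.smul_mem (1 / 4 : ℝ) h2
  rwa [← Complex.coe_smul] at h3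

theorem pauliAt_conj_pauliString (a : Fin 3) (k : Fin N) (f : Fin N → Option (Fin 3)) :
    pauliAt a k * (pauliString f * pauliAt a k) =
      (if f k = none ∨ f k = some a then (1 : ℂ) else -1) • pauliString f := by
  have h1 : pauli a * (pauliOp (f k) * pauli a) =
      (if f k = none ∨ f k = some a then (1 : ℂ) else -1) • pauliOp (f k) := by
    rcases h : f k with _ | b
    · simp [pauliOp, pauli_mul_self]
    · rcases eq_or_ne a b with rfl | hab
      · simp [pauliOp, pauli_mul_self]
      · rw [← mul_assoc]
        simp [pauliOp, pauli_conj_of_ne hab, hab.symm]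
  have h2 : pauliString f = tensorOpUpdate (fun l => pauliOp (f l)) k (pauliOp (f k)) := by
    change _ = tensorOp _
    rw [Function.update_eq_self k fun l => pauliOp (f l)]
    rfl
  conv_rhs => rw [h2, ← map_smul, ← h1]
  rw [pauliAt_eq_tensorOp, pauliString, tensorOp_mul, tensorOp_mul]
  change _ = tensorOp _
  congr 1
  ext1 l
  rcases eq_or_ne l k with rfl | hl
  · simp
  · simp [hl]

theorem pauliProj_pauliString (k : Fin N) (a : Fin 3) (f : Fin N → Option (Fin 3)) :
    pauliProj k a (pauliString f) = if f k = some a then pauliString f else 0 := by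
  have h : ∀ Y, pauliProj k a Y = ((1 / 4 : ℝ) : ℂ) • ((Y + pauliAt a k * (Y * pauliAt a k)) -
      pauliAt (a + 1) k * ((Y + pauliAt a k * (Y * pauliAt a k)) * pauliAt (a + 1) k)) :=
    fun Y => rfl
  rw [h, pauliAt_conj_pauliString]
  have ha : a + 1 ≠ a := (by decide : ∀ a : Fin 3, a + 1 ≠ a) a
  rcases hf : f k with _ | b
  · simp only [true_or, if_true, one_smul, add_mul, mul_add, pauliAt_conj_pauliString, hf]
    simp
  · rcases eq_or_ne b a with rfl | hb
    · simp only [or_true, if_true, one_smul, add_mul, mul_add, pauliAt_conj_pauliString, hf]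
      simp only [reduceCtorEq, Option.some.injEq, ha.symm, or_self, if_false, ← two_smul ℂ
        (pauliString f), neg_smul, one_smul, ← neg_add, sub_neg_eq_add, ← add_smul, smul_smul]
      norm_num
    · simp [hb]

theorem pauliProj_interaction (J : Fin N → Fin N → Fin 3 → Fin 3 → ℝ) {i j : Fin N} (hij : i < j)
    (p q : Fin 3) :
    pauliProj i p (pauliProj j q (interaction J)) = (J i j p q : ℂ) • (pauliAt p i * pauliAt q j) := by
  have key : ∀ i' j' : Fin N, i' < j' → ∀ a b : Fin 3,
      pauliProj i p (pauliProj j q (pauliAt a i' * pauliAt b j')) =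
        if i' = i ∧ j' = j ∧ a = p ∧ b = q then pauliAt p i * pauliAt q j else 0 := by
    intro i' j' h a b
    rw [pauliAt_mul_pauliAt h.ne, pauliProj_pauliString]
    split_ifs with h1 h2 h2
    · obtain ⟨rfl, rfl, rfl, rfl⟩ := h2
      rw [pauliProj_pauliString, pauliAt_mul_pauliAt h.ne]
      simp [h.ne]
    · rw [pauliProj_pauliString, if_neg]
      intro h3
      apply h2
      simp only [Function.update_apply] at h1 h3
      grind
    · obtain ⟨rfl, rfl, rfl, rfl⟩ := h2
      simp at h1
    · exact map_zero _
  rw [interaction, map_sum, map_sum, Finset.sum_eq_single i, map_sum, map_sum,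
    Finset.sum_eq_single j, if_pos hij]
  · simp only [map_sum, map_smul, key i j hij, true_and]
    rw [Finset.sum_eq_single p, Finset.sum_eq_single q]
    · simp
    · intro b _ hb
      simp [hb]
    · simp
    · intro a _ ha
      simp [ha]
    · simp
  · intro j' _ hj
    split_ifs with h
    · simp [map_sum, key i j' h, hj]
    · simp
  · simp
  · intro i' _ hi
    rw [map_sum, map_sum]
    refine Finset.sum_eq_zero fun j' _ => ?_
    split_ifs with h
    · simp [map_sum, key i' j' h, hi]
    · simp
  · simp

/-- A bracket-closed space that contains the strings `f` and `g` contains their product `h` up to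
phase when they anticommute at the qubit `j` and commute everywhere else. -/
theorem pauliString_mem_of_commutator {L : Submodule ℝ (QubitOp N)}
    (hL : ∀ A ∈ L, ∀ B ∈ L, I • (A * B - B * A) ∈ L) {f g h : Fin N → Option (Fin 3)}
    (hf : pauliString f ∈ L) (hg : pauliString g ∈ L) (j : Fin N) {a b c : Fin 3}
    (hab : a ≠ b) (hac : a ≠ c) (hbc : b ≠ c)
    (hfj : f j = some a) (hgj : g j = some b) (hhj : h j = some c)
    (hne : ∀ l, l ≠ j → f l = none ∧ h l = g l ∨ g l = none ∧ h l = f l ∨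
      f l = g l ∧ h l = none) : pauliString h ∈ L := by
  have hl : ∀ l, l ≠ j → pauliOp (f l) * pauliOp (g l) = pauliOp (h l) ∧
      pauliOp (g l) * pauliOp (f l) = pauliOp (h l) := by
    intro l hl
    rcases hne l hl with ⟨h1, h2⟩ | ⟨h1, h2⟩ | ⟨h1, h2⟩
    · rw [h1, h2]; simp [pauliOp]
    · rw [h1, h2]; simp [pauliOp]
    · rw [h1, h2]
      rcases g l with _ | b <;> simp [pauliOp, pauli_mul_self]
  have hmem := hL _ hf _ hg
  obtain ⟨s, hs, hcomm⟩ := pauli_commutator hab hac hbc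
  have hcalc : I • (pauliString f * pauliString g - pauliString g * pauliString f) =
      s • pauliString h := by
    rw [pauliString, pauliString, tensorOp_commutator _ _ j
      fun l hlj => (hl l hlj).1.trans (hl l hlj).2.symm]
    change I • tensorOpUpdate _ j _ = _
    rw [← map_smul, hfj, hgj]
    change tensorOpUpdate _ j (I • (pauli a * pauli b - pauli b * pauli a)) = _
    rw [hcomm, map_smul, Complex.coe_smul]
    congr 1
    change tensorOp _ = tensorOp _
    congr 1
    ext1 l
    rcases eq_or_ne l j with rfl | hlj
    · rw [Function.update_self, hhj]
      rfl
    · rw [Function.update_of_ne hlj]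
      exact (hl l hlj).1
  rw [hcalc] at hmem
  exact (L.smul_mem_iff hs).1 hmem

/-! ### Generating all Pauli strings -/

/-- The label of the two-qubit string `σ_a^{(i)} σ_b^{(j)}`, for `i ≠ j`. -/
def pairLabel (i : Fin N) (a : Fin 3) (j : Fin N) (b : Fin 3) : Fin N → Option (Fin 3) :=
  Function.update (Function.update (fun _ => none) i (some a)) j (some b)

theorem exists_third {a b : Fin 3} (h : a ≠ b) : ∃ c, a ≠ c ∧ c ≠ b := by
  revert a b; decide

theorem exists_other_two (c : Fin 3) : ∃ a b : Fin 3, a ≠ b ∧ a ≠ c ∧ b ≠ c := by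
  revert c; decide

theorem pauliString_update_mem {L : Submodule ℝ (QubitOp N)}
    (hL : ∀ A ∈ L, ∀ B ∈ L, I • (A * B - B * A) ∈ L) (hloc : ∀ a k, pauliAt a k ∈ L)
    {f : Fin N → Option (Fin 3)} (hf : pauliString f ∈ L) {k : Fin N} (hk : f k ≠ none)
    (a : Fin 3) : pauliString (Function.update f k (some a)) ∈ L := by
  obtain ⟨p, hp⟩ := Option.ne_none_iff_exists'.1 hk
  rcases eq_or_ne p a with rfl | hpa
  · rwa [← hp, Function.update_eq_self]
  · obtain ⟨c, h1, h2⟩ := exists_third hpa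
    have hg := hloc c k
    rw [pauliAt_eq_pauliString] at hg
    exact pauliString_mem_of_commutator hL hf hg k h1 hpa h2 hp (by simp) (by simp)
      fun l hl => by simp [hl]

/-- Projecting the interaction onto a nonzero coefficient of an edge isolates one two-qubit term of
that edge, and local brackets turn it into all of them. -/
theorem pairLabel_mem_of_adj {L : Submodule ℝ (QubitOp N)}
    (hL : ∀ A ∈ L, ∀ B ∈ L, I • (A * B - B * A) ∈ L) (hloc : ∀ a k, pauliAt a k ∈ L)
    {J : Fin N → Fin N → Fin 3 → Fin 3 → ℝ} (hJ : interaction J ∈ L) {i j : Fin N}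
    (h : (couplingGraph J).Adj i j) (a b : Fin 3) : pauliString (pairLabel i a j b) ∈ L := by
  have key : ∀ i j : Fin N, i < j → J i j ≠ 0 → ∀ a b, pauliString (pairLabel i a j b) ∈ L := by
    intro i j hij hne a b
    obtain ⟨p, hp⟩ := Function.ne_iff.1 hne
    obtain ⟨q, hq⟩ := Function.ne_iff.1 hp
    have h1 := pauliProj_mem hL (fun a => hloc a i) p (pauliProj_mem hL (fun a => hloc a j) q hJ)
    rw [pauliProj_interaction J hij, pauliAt_mul_pauliAt hij.ne, Complex.coe_smul,
      L.smul_mem_iff hq] at h1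
    have h2 := pauliString_update_mem hL hloc h1 (k := i) (by simp [hij.ne]) a
    have h3 := pauliString_update_mem hL hloc h2 (k := j) (by simp [hij.ne']) b
    convert h3 using 2
    ext1 l
    simp only [pairLabel, Function.update_apply]
    split_ifs <;> rfl
  rcases ((SimpleGraph.fromRel_adj _ _ _).1 h) with ⟨hne, ⟨h1, h2⟩ | ⟨h1, h2⟩⟩
  · exact key i j h1 h2 a b
  · have := key j i h1 h2 b a
    rwa [pairLabel, Function.update_comm hne.symm] at this

/-- The terms on `u, v` and on `v, w` give those on `u, w`, through a term
`σ_a^{(u)} σ_z^{(v)} σ_d^{(w)}` whose middle factor is then cancelled by `σ_z^{(v)} σ_e^{(w)}`. -/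
theorem pairLabel_mem_trans {L : Submodule ℝ (QubitOp N)}
    (hL : ∀ A ∈ L, ∀ B ∈ L, I • (A * B - B * A) ∈ L) {u v w : Fin N}
    (huv : u ≠ v) (hvw : v ≠ w) (huw : u ≠ w)
    (h1 : ∀ a b, pauliString (pairLabel u a v b) ∈ L)
    (h2 : ∀ a b, pauliString (pairLabel v a w b) ∈ L) (a b : Fin 3) :
    pauliString (pairLabel u a w b) ∈ L := by
  obtain ⟨d, e, hde, hdb, heb⟩ := exists_other_two b
  have h3 : pauliString (Function.update (pairLabel u a v 2) w (some d)) ∈ L := by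
    refine pauliString_mem_of_commutator hL (h1 a 0) (h2 1 d) v (a := 0) (b := 1) (c := 2)
      (by decide) (by decide) (by decide) ?_ ?_ ?_ ?_
    · simp [pairLabel]
    · simp [pairLabel, hvw]
    · simp [pairLabel, hvw]
    · intro l hl
      simp only [pairLabel, Function.update_apply]
      grind
  refine pauliString_mem_of_commutator hL h3 (h2 2 e) w hde hdb heb ?_ ?_ ?_ ?_
  · simp
  · simp [pairLabel]
  · simp [pairLabel]
  · intro l hl
    simp only [pairLabel, Function.update_apply]
    grind

theorem pairLabel_mem_of_connected {L : Submodule ℝ (QubitOp N)}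
    (hL : ∀ A ∈ L, ∀ B ∈ L, I • (A * B - B * A) ∈ L) {Γ : SimpleGraph (Fin N)}
    (hΓ : Γ.Connected)
    (hadj : ∀ i j, Γ.Adj i j → ∀ a b, pauliString (pairLabel i a j b) ∈ L) {i j : Fin N}
    (hij : i ≠ j) (a b : Fin 3) : pauliString (pairLabel i a j b) ∈ L := by
  obtain ⟨p⟩ := hΓ.preconnected i j
  induction p generalizing a b with
  | nil => exact absurd rfl hij
  | @cons u v w h p ih =>
    rcases eq_or_ne v w with rfl | hvw
    · exact hadj u v h a b
    · exact pairLabel_mem_trans hL h.ne hvw hij (hadj u v h) (fun a b => ih hvw a b) a b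

/-- One- and two-qubit strings generate all nonidentity strings: a string that acts on `j` and `k`
is, up to a factor, the bracket of a string that does not act on `k` and a two-qubit string. -/
theorem pauliString_mem_of_pairLabel_mem {L : Submodule ℝ (QubitOp N)}
    (hL : ∀ A ∈ L, ∀ B ∈ L, I • (A * B - B * A) ∈ L) (hloc : ∀ a k, pauliAt a k ∈ L)
    (hpair : ∀ i j, i ≠ j → ∀ a b, pauliString (pairLabel i a j b) ∈ L)
    (f : Fin N → Option (Fin 3)) (hf : f ≠ fun _ => none) : pauliString f ∈ L := by
  classical
  induction hn : (Finset.univ.filter fun l => f l ≠ none).card using Nat.strong_induction_on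
    generalizing f with
  | _ n ih =>
  obtain ⟨j, hj⟩ := Function.ne_iff.1 hf
  obtain ⟨b, hb⟩ := Option.ne_none_iff_exists'.1 hj
  by_cases hk : ∃ k, k ≠ j ∧ f k ≠ none
  · obtain ⟨k, hkj, hk⟩ := hk
    obtain ⟨c, hc⟩ := Option.ne_none_iff_exists'.1 hk
    obtain ⟨b₁, b₂, h12, h1, h2⟩ := exists_other_two b
    have hf' : pauliString (Function.update (Function.update f k none) j (some b₁)) ∈ L := by
      refine ih _ ?_ _ (fun h => by simpa using congrFun h j) rfl
      rw [← hn]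
      refine Finset.card_lt_card (Finset.ssubset_iff_of_subset ?_ |>.2 ⟨k, by simp [hk], ?_⟩)
      · intro l
        simp only [Finset.mem_filter, Finset.mem_univ, true_and, Function.update_apply]
        split_ifs with h3 h4
        · rw [h3, hb]; simp
        · simp
        · exact id
      · simp [hkj]
    refine pauliString_mem_of_commutator hL hf' (hpair j k hkj.symm b₂ c) j h12 h1 h2 (by simp)
      (by simp [pairLabel, hkj.symm]) hb ?_
    intro l hl
    simp only [pairLabel, Function.update_apply]
    grind
  · push Not at hk
    have : f = Function.update (fun _ => none) j (some b) := by
      ext1 l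
      rcases eq_or_ne l j with rfl | hl
      · simp [hb]
      · simp [hl, hk l hl]
    rw [this, ← pauliAt_eq_pauliString]
    exact hloc b j

/-! ### The switched device -/

/-- The real space of traceless Hermitian operators. -/
def tracelessHermitian (N : ℕ) : Submodule ℝ (QubitOp N) where
  carrier := {A | A.IsHermitian ∧ A.trace = 0}
  add_mem' h1 h2 := ⟨h1.1.add h2.1, by rw [trace_add, h1.2, h2.2, add_zero]⟩
  zero_mem' := ⟨isHermitian_zero, trace_zero _ _⟩
  smul_mem' r A h := ⟨by
    rw [IsHermitian, conjTranspose_smul, h.1.eq, star_trivial], by rw [trace_smul, h.2, smul_zero]⟩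

theorem switchedHamiltonian_mem_tracelessHermitian (B : Fin N → Bool → Fin 3 → ℝ)
    (J : Fin N → Fin N → Fin 3 → Fin 3 → ℝ) (g : Bool → ℝ) (s : Fin (N + 1) → Bool) :
    switchedHamiltonian B J g s ∈ tracelessHermitian N := by
  have hps : ∀ f : Fin N → Option (Fin 3), f ≠ (fun _ => none) →
      pauliString f ∈ tracelessHermitian N :=
    fun f hf => ⟨pauliString_isHermitian f, pauliString_trace hf⟩
  refine Submodule.add_mem _ (Submodule.sum_mem _ fun k _ => Submodule.sum_mem _ fun a _ => ?_) ?_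
  · rw [Complex.coe_smul, pauliAt_eq_pauliString]
    exact Submodule.smul_mem _ _ (hps _ fun h => by simpa using congrFun h k)
  · rw [Complex.coe_smul]
    refine Submodule.smul_mem _ _ (Submodule.sum_mem _ fun i _ => Submodule.sum_mem _ fun j _ => ?_)
    split_ifs with hij
    · refine Submodule.sum_mem _ fun a _ => Submodule.sum_mem _ fun b _ => ?_
      rw [Complex.coe_smul, pauliAt_mul_pauliAt hij.ne]
      exact Submodule.smul_mem _ _ (hps _ fun h => by simpa using congrFun h j)
    · exact Submodule.zero_mem _

/-- The Hamiltonians of the device generate all nonidentity Pauli strings under `i[·, ·]`: flipping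
one switch isolates the interaction, or the difference of the two fields on one qubit. -/
theorem pauliString_mem_of_switchedHamiltonian_mem {L : Submodule ℝ (QubitOp N)}
    (hL : ∀ A ∈ L, ∀ B ∈ L, I • (A * B - B * A) ∈ L)
    {B : Fin N → Bool → Fin 3 → ℝ} {J : Fin N → Fin N → Fin 3 → Fin 3 → ℝ} {g : Bool → ℝ}
    (hB : ∀ k, LinearIndependent ℝ ![B k false, B k true])
    (hJ : (couplingGraph J).Connected) (hg : g false ≠ g true)
    (hH : ∀ s, switchedHamiltonian B J g s ∈ L)
    (f : Fin N → Option (Fin 3)) (hf : f ≠ fun _ => none) : pauliString f ∈ L := by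
  set s₀ : Fin (N + 1) → Bool := fun _ => false with hs₀
  have hint : interaction J ∈ L := by
    have h1 := L.sub_mem (hH (Function.update s₀ (Fin.last N) true)) (hH s₀)
    have h2 : switchedHamiltonian B J g (Function.update s₀ (Fin.last N) true) -
        switchedHamiltonian B J g s₀ = (g true - g false) • interaction J := by
      simp [switchedHamiltonian, hs₀, sub_smul]
    rw [h2] at h1
    exact (L.smul_mem_iff (sub_ne_zero.2 hg.symm)).1 h1
  have hsum : ∑ k, localField k (B k false) ∈ L := by
    have h1 := L.sub_mem (hH s₀) (L.smul_mem (g false) hint)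
    simpa [switchedHamiltonian, hs₀] using h1
  have hdiff : ∀ k, localField k (B k true - B k false) ∈ L := by
    intro k
    have h1 := L.sub_mem (hH (Function.update s₀ k.castSucc true)) (hH s₀)
    have h2 : switchedHamiltonian B J g (Function.update s₀ k.castSucc true) -
        switchedHamiltonian B J g s₀ = localField k (B k true - B k false) := by
      rw [switchedHamiltonian, switchedHamiltonian,
        Function.update_of_ne (Fin.castSucc_lt_last k).ne', add_sub_add_right_eq_sub,
        ← Finset.sum_sub_distrib, Finset.sum_eq_single k]
      · rw [Function.update_self]
        exact (map_sub (localFieldLinear k) _ _).symm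
      · intro j _ hj
        rw [Function.update_of_ne (fun h => hj (Fin.castSucc_injective N h)), sub_self]
      · simp
    rwa [h2] at h1
  have hfield : ∀ k v, localField k v ∈ L := by
    intro k v
    refine localField_mem_of_switch hL _ hsum (hdiff k) ?_ v
    rw [map_sub, LinearMap.sub_apply, cross_self, sub_zero, ← cross_anticomm, neg_ne_zero]
    exact crossProduct_ne_zero_iff_linearIndependent.2 (hB k)
  have hloc : ∀ a k, pauliAt a k ∈ L := fun a k => localField_single k a ▸ hfield k _
  exact pauliString_mem_of_pairLabel_mem hL hloc
    (fun i j hij => pairLabel_mem_of_connected hL hJ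
      (fun i j h => pairLabel_mem_of_adj hL hloc hint h) hij) f hf

/-- The operators that are finite products of evolutions under the Hamiltonians `H s`. -/
noncomputable def reachableOps {M : ℕ} (H : (Fin M → Bool) → QubitOp N) :
    Submonoid (QubitOp N) where
  carrier := {W | ∃ l : List ((Fin M → Bool) × ℝ),
    (l.map fun p => NormedSpace.exp (-(I * (p.2 : ℂ)) • H p.1)).prod = W}
  mul_mem' := by
    rintro _ _ ⟨l, rfl⟩ ⟨l', rfl⟩
    exact ⟨l ++ l', by rw [List.map_append, List.prod_append]⟩
  one_mem' := ⟨[], rfl⟩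

end

theorem proposition1 (N : ℕ)
    (B : Fin N → Bool → Fin 3 → ℝ) (J : Fin N → Fin N → Fin 3 → Fin 3 → ℝ) (g : Bool → ℝ)
    (hB : ∀ k, LinearIndependent ℝ ![B k false, B k true])
    (hJ : (couplingGraph J).Connected)
    (hg : g false ≠ g true) :
    IsUniversal (switchedHamiltonian B J g) := by
  refine specialUnitaryGroup_le_of_traceless_mem_drivableSpan
    (G := reachableOps (switchedHamiltonian B J g)) fun A hA h0 => ?_
  refine traceless_isHermitian_mem (fun f hf => ?_) hA h0
  refine pauliString_mem_of_switchedHamiltonian_mem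
    (fun A hA B hB => commutator_mem_drivableSpan hA hB) hB hJ hg (fun s => ?_) f hf
  have hH := switchedHamiltonian_mem_tracelessHermitian B J g s
  exact Submodule.subset_span ⟨hH.1, hH.2, fun t => ⟨[(s, t)], by simp⟩⟩
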